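/- For an input $x\in\{0,1\}^N$ let $|x|$ be its Hamming weight, and for a positive integer $q$ let $\mathrm{count}_q:\{0,1\}^N\to\{0,1,\dots,q-1\}$ be the function $\mathrm{count}_q(x)=|x| \bmod q$. A $T$-query quantum algorithm on $N$-bit inputs starts in a fixed state $|\psi_0\rangle$, applies $U_0,O_x,U_1,O_x,\dots,O_x,U_T$, with $T$ applications of the query unitary $O_x:|i\rangle|b\rangle|w\rangle\mapsto|i\rangle|b+x_i \bmod 2\rangle|w\rangle$ (where $i$ ranges over the $N$ positions, $b\in\{0,1\}$, and $w$ over a basis of a finite-dimensional workspace), and then performs a measurement whose outcome is its output; the state $|\psi_0\rangle$, the unitaries $U_0,\dots,U_T$ and the measurement do not depend on $x$. It computes a function $f$ on $\{0,1\}^N$ with error probability at most $1/3$ if, for every $x\in\{0,1\}^N$, it outputs $f(x)$ with probability at least $2/3$. The bounded-error quantum query complexity $\mathsf{Q}(f)$ is the least $T$ for which such an algorithm exists. Then for integers $q\in[3,N/2]$, $$\mathsf{Q}(\mathrm{count}_q)=\Omega\big(\sqrt{N(N-2q+1)}\big),$$ that is, there is an absolute constant $c>0$ such that $\mathsf{Q}(\mathrm{count}_q)\ge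 c\sqrt{N(N-2q+1)}$ for all positive integers $N$ and all integers $q$ with $3\le q\le N/2$. -/

import Mathlib

namespace QuantumQuery

open Matrix
open scoped ComplexOrder

/-- Labels of the computational basis states `|i⟩|b⟩|w⟩`: a query index `i`, a target bit `b`,
and a state `w` of a workspace of dimension `d`. -/
abbrev BasisIndex (N d : ℕ) : Type := Fin N × Bool × Fin d

/-- The query operator `O_x`, which maps `|i⟩|b⟩|w⟩` to `|i⟩|b + x_i mod 2⟩|w⟩`. -/
def oracle {N : ℕ} (d : ℕ) (x : Fin N → Bool) :
    Matrix (BasisIndex N d) (BasisIndex N d) ℂ :=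
  Matrix.of fun r s => if r = (s.1, xor s.2.1 (x s.1), s.2.2) then 1 else 0

theorem oracle_mulVec_single {N d : ℕ} (x : Fin N → Bool) (i : Fin N) (b : Bool) (w : Fin d) :
    oracle d x *ᵥ Pi.single (i, b, w) (1 : ℂ) = Pi.single (i, xor b (x i), w) (1 : ℂ) := by
  ext r
  simp [oracle, Pi.single_apply]

/-- A quantum query algorithm on `N`-bit inputs with outputs in the finite set `α`. The number of
queries, the workspace dimension, the initial state, the unitaries and the final measurement do
not depend on the input. The final measurement is an arbitrary one (a POVM). -/
structure Algorithm (N : ℕ) (α : Type*) [Fintype α] where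
  /-- number of queries -/
  cost : ℕ
  /-- dimension of the workspace -/
  dim : ℕ
  /-- initial state, a unit vector -/
  init : BasisIndex N dim → ℂ
  init_unit : star init ⬝ᵥ init = 1
  /-- the unitaries `U_0, U_1, …, U_cost`; later entries of the sequence are never used -/
  unitaries : ℕ → Matrix.unitaryGroup (BasisIndex N dim) ℂ
  /-- the measurement operator of each outcome -/
  meas : α → Matrix (BasisIndex N dim) (BasisIndex N dim) ℂ
  meas_posSemidef : ∀ z, (meas z).PosSemidef
  meas_sum : ∑ z, meas z = 1

namespace Algorithm

variable {N : ℕ} {α : Type*} [Fintype α]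

/-- The state `U_t O_x U_{t-1} ⋯ O_x U_0 |ψ_0⟩` after `t` queries to the input `x`. -/
def state (A : Algorithm N α) (x : Fin N → Bool) : ℕ → (BasisIndex N A.dim → ℂ)
  | 0 => (A.unitaries 0).1 *ᵥ A.init
  | t + 1 => (A.unitaries (t + 1)).1 *ᵥ (oracle A.dim x *ᵥ A.state x t)

/-- The probability that the algorithm outputs `z` on input `x`. -/
def outputProb (A : Algorithm N α) (x : Fin N → Bool) (z : α) : ℝ :=
  (star (A.state x A.cost) ⬝ᵥ (A.meas z *ᵥ A.state x A.cost)).re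

/-- The algorithm computes `f` with error probability at most `1/3` on every input. -/
def Computes (A : Algorithm N α) (f : (Fin N → Bool) → α) : Prop :=
  ∀ x, 2 / 3 ≤ A.outputProb x (f x)

end Algorithm

/-- The `1/3`-bounded-error quantum query complexity `Q(f)`: the least number of queries of an
algorithm that computes `f` with error probability at most `1/3`. -/
noncomputable def queryComplexity {N : ℕ} {α : Type*} [Fintype α]
    (f : (Fin N → Bool) → α) : ℕ∞ :=
  ⨅ (A : Algorithm N α) (_ : A.Computes f), (A.cost : ℕ∞)

/-- The Hamming weight of a bit string. -/
def count {N : ℕ} (x : Fin N → Bool) : ℕ :=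
  (Finset.univ.filter fun i => x i = true).card

/-- The Hamming weight modulo `q`, as an element of `{0, …, q - 1}`. -/
def countMod (N : ℕ) {q : ℕ} (hq : 0 < q) (x : Fin N → Bool) : Fin q :=
  ⟨count x % q, Nat.mod_lt _ hq⟩

end QuantumQuery

namespace QuantumQuery

open Matrix
open scoped ComplexOrder

/-! Flipping any bit of any input changes the weight by one, hence changes its residue mod `q`. An
adversary argument over all pairs of adjacent inputs then gives a bound linear in `N`, which
suffices because the square root is at most `N`. The real inner products of the two states, summed
over the `N * 2 ^ N` ordered pairs, start at `N * 2 ^ N`. A query lowers the sum by at most `2 * 2 ^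
N` (`progress_sub_succ_le`), and correctness forces each final term to be at most `17 / 18`
(`re_inner_state_le`). -/

/-- The bit string `x` with its `i`-th bit flipped. -/
def flipBit {N : ℕ} (x : Fin N → Bool) (i : Fin N) : Fin N → Bool :=
  Function.update x i (!x i)

theorem flipBit_flipBit {N : ℕ} (x : Fin N → Bool) (i : Fin N) :
    flipBit (flipBit x i) i = x := by
  simp [flipBit]

theorem sum_flipBit {N : ℕ} (i : Fin N) (g : (Fin N → Bool) → ℝ) :
    ∑ x, g (flipBit x i) = ∑ x, g x :=
  Equiv.sum_comp (Function.Involutive.toPerm (fun x => flipBit x i)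
    fun x => flipBit_flipBit x i) g

theorem count_update_true {N : ℕ} (x : Fin N → Bool) (i : Fin N) (hi : x i = false) :
    count (Function.update x i true) = count x + 1 := by
  have h : (Finset.univ.filter fun j => Function.update x i true j = true)
      = insert i (Finset.univ.filter fun j => x j = true) := by
    ext j
    by_cases hj : j = i <;> simp [Function.update_apply, hj]
  unfold count
  rw [h, Finset.card_insert_of_notMem (by simp [hi])]

theorem add_one_mod_ne {q : ℕ} (hq : 2 ≤ q) (n : ℕ) : (n + 1) % q ≠ n % q := by
  intro h
  have h' : 1 ≡ 0 [MOD q] := Nat.ModEq.add_left_cancel' n h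
  have := Nat.le_of_dvd one_pos ((Nat.modEq_zero_iff_dvd).1 h')
  omega

theorem countMod_flipBit_ne {N q : ℕ} (hq : 2 ≤ q) (hq0 : 0 < q) (x : Fin N → Bool) (i : Fin N) :
    countMod N hq0 (flipBit x i) ≠ countMod N hq0 x := by
  have key : ∀ y : Fin N → Bool, y i = false →
      countMod N hq0 (flipBit y i) ≠ countMod N hq0 y := by
    intro y hy h
    have h' := congrArg Fin.val h
    simp only [countMod, flipBit, hy, Bool.not_false, count_update_true y i hy] at h'
    exact add_one_mod_ne hq _ h'
  cases hx : x i with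
  | false => exact key x hx
  -- Flipping is an involution, so this is the previous case read from the flipped string.
  | true =>
    have h := key (flipBit x i) (by simp [flipBit, hx])
    rw [flipBit_flipBit] at h
    exact h.symm

/-- The total weight of the basis states with query index `i` in the vector `u`. -/
noncomputable def queryWeight {N d : ℕ} (u : BasisIndex N d → ℂ) (i : Fin N) : ℝ :=
  ∑ p : Bool × Fin d, ‖u (i, p)‖ ^ 2

theorem sum_queryWeight {N d : ℕ} (u : BasisIndex N d → ℂ) :
    ∑ i, queryWeight u i = (star u ⬝ᵥ u).re := by
  simp only [queryWeight, dotProduct, Complex.re_sum, Pi.star_apply]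
  rw [← Fintype.sum_prod_type' (f := fun (i : Fin N) (p : Bool × Fin d) => ‖u (i, p)‖ ^ 2)]
  refine Finset.sum_congr rfl fun r _ => ?_
  rw [Complex.star_def, ← Complex.normSq_eq_conj_mul_self, Complex.ofReal_re,
    Complex.normSq_eq_norm_sq]

theorem oracle_mulVec_apply {N d : ℕ} (x : Fin N → Bool) (u : BasisIndex N d → ℂ)
    (i : Fin N) (p : Bool × Fin d) :
    (oracle d x *ᵥ u) (i, p) = u (i, xor p.1 (x i), p.2) := by
  obtain ⟨b, w⟩ := p
  rw [mulVec, dotProduct, Finset.sum_eq_single (i, xor b (x i), w)]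
  · simp [oracle]
  · rintro ⟨j, c, v⟩ _ hne
    have : ¬ (i, b, w) = (j, xor c (x j), v) := by
      intro h
      simp only [Prod.mk.injEq] at h
      obtain ⟨rfl, rfl, rfl⟩ := h
      simp at hne
    simp only [oracle, of_apply, if_neg this, zero_mul]
  · simp

/-- The permutation of the pairs `(b, w)` which adds `c` to the bit `b`. -/
def xorEquiv (d : ℕ) (c : Bool) : Bool × Fin d ≃ Bool × Fin d :=
  Function.Involutive.toPerm (fun p => (xor p.1 c, p.2)) fun p => by simp

theorem sum_xor {d : ℕ} {β : Type*} [AddCommMonoid β] (c : Bool) (h : Bool × Fin d → β) :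
    ∑ p : Bool × Fin d, h (xor p.1 c, p.2) = ∑ p, h p :=
  Equiv.sum_comp (xorEquiv d c) h

theorem queryWeight_oracle {N d : ℕ} (x : Fin N → Bool) (u : BasisIndex N d → ℂ) (i : Fin N) :
    queryWeight (oracle d x *ᵥ u) i = queryWeight u i := by
  simp only [queryWeight, oracle_mulVec_apply]
  exact sum_xor (x i) fun p => ‖u (i, p)‖ ^ 2

theorem abs_re_sum_star_mul_le {N d : ℕ} (u v : BasisIndex N d → ℂ) (i : Fin N) :
    |(∑ p : Bool × Fin d, star (u (i, p)) * v (i, p)).re|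
      ≤ (queryWeight u i + queryWeight v i) / 2 := by
  rw [queryWeight, queryWeight, ← Finset.sum_add_distrib, Finset.sum_div]
  refine (Complex.abs_re_le_norm _).trans ((norm_sum_le _ _).trans
    (Finset.sum_le_sum fun p _ => ?_))
  rw [norm_mul, norm_star]
  nlinarith [sq_nonneg (‖u (i, p)‖ - ‖v (i, p)‖)]

/-- One query to two inputs that differ in the bit `i` only changes the real part of the inner
product of two states by at most their weights at the index `i`. -/
theorem re_inner_sub_oracle_le {N d : ℕ} (x : Fin N → Bool) (i : Fin N)
    (u v : BasisIndex N d → ℂ) :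
    (star u ⬝ᵥ v).re - (star (oracle d x *ᵥ u) ⬝ᵥ (oracle d (flipBit x i) *ᵥ v)).re
      ≤ queryWeight u i + queryWeight v i := by
  have split : ∀ a b : BasisIndex N d → ℂ, (star a ⬝ᵥ b).re
      = ∑ j, (∑ p : Bool × Fin d, star (a (j, p)) * b (j, p)).re := by
    intro a b
    simp only [dotProduct, Pi.star_apply, Fintype.sum_prod_type, Complex.re_sum]
  rw [split, split, ← Finset.sum_sub_distrib, Finset.sum_eq_single i]
  · have h1 := abs_le.1 (abs_re_sum_star_mul_le u v i)
    have h2 := abs_le.1 (abs_re_sum_star_mul_le (oracle d x *ᵥ u) (oracle d (flipBit x i) *ᵥ v) i)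
    rw [queryWeight_oracle, queryWeight_oracle] at h2
    linarith [h1.2, h2.1]
  -- On a block `j ≠ i` both oracles apply the same permutation, so the inner product there is
  -- unchanged.
  · intro j _ hj
    have hx : flipBit x i j = x j := by simp [flipBit, hj]
    simp only [oracle_mulVec_apply, hx]
    rw [sum_xor (x j) fun p => star (u (j, p)) * v (j, p), sub_self]
  · simp

theorem inner_unitary_mulVec {n : Type*} [Fintype n] [DecidableEq n]
    (U : Matrix.unitaryGroup n ℂ) (u v : n → ℂ) :
    star (U.1 *ᵥ u) ⬝ᵥ (U.1 *ᵥ v) = star u ⬝ᵥ v := by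
  rw [star_mulVec, dotProduct_mulVec, vecMul_vecMul, ← star_eq_conjTranspose,
    Matrix.UnitaryGroup.star_mul_self, vecMul_one]

theorem inner_oracle_mulVec_self {N d : ℕ} (x : Fin N → Bool) (u : BasisIndex N d → ℂ) :
    (star (oracle d x *ᵥ u) ⬝ᵥ (oracle d x *ᵥ u)).re = (star u ⬝ᵥ u).re := by
  simp only [← sum_queryWeight, queryWeight_oracle]

/-- The AM-GM inequality for the semi-inner product of a positive semidefinite matrix. -/
theorem _root_.Matrix.PosSemidef.re_dotProduct_mulVec_le {n : Type*} [Fintype n]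
    {M : Matrix n n ℂ} (hM : M.PosSemidef) (u v : n → ℂ) (a b : ℝ) :
    2 * (a * b) * (star u ⬝ᵥ (M *ᵥ v)).re
      ≤ a ^ 2 * (star u ⬝ᵥ (M *ᵥ u)).re + b ^ 2 * (star v ⬝ᵥ (M *ᵥ v)).re := by
  have h := (Complex.le_def.1 (hM.dotProduct_mulVec_nonneg ((a : ℂ) • u - (b : ℂ) • v))).1
  have hsymm : (star v ⬝ᵥ (M *ᵥ u)).re = (star u ⬝ᵥ (M *ᵥ v)).re := by
    have : star (star u ⬝ᵥ (M *ᵥ v)) = star v ⬝ᵥ (M *ᵥ u) := by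
      rw [star_dotProduct, star_star, star_mulVec, hM.isHermitian.eq, ← dotProduct_mulVec]
    rw [← this, Complex.star_def, Complex.conj_re]
  simp only [star_sub, star_smul, Complex.star_def, Complex.conj_ofReal, mulVec_sub, mulVec_smul,
    sub_dotProduct, dotProduct_sub, smul_dotProduct, dotProduct_smul, smul_eq_mul, Complex.sub_re,
    Complex.re_ofReal_mul, Complex.zero_re, hsymm] at h
  linarith

namespace Algorithm

variable {N : ℕ} {α : Type*} [Fintype α]

theorem inner_state_self (A : Algorithm N α) (x : Fin N → Bool) (t : ℕ) :
    (star (A.state x t) ⬝ᵥ A.state x t).re = 1 := by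
  induction t with
  | zero => rw [state, inner_unitary_mulVec, A.init_unit, Complex.one_re]
  | succ t ih => rw [state, inner_unitary_mulVec, inner_oracle_mulVec_self, ih]

theorem outputProb_nonneg (A : Algorithm N α) (x : Fin N → Bool) (z : α) :
    0 ≤ A.outputProb x z :=
  (Complex.le_def.1 ((A.meas_posSemidef z).dotProduct_mulVec_nonneg _)).1

theorem sum_outputProb (A : Algorithm N α) (x : Fin N → Bool) :
    ∑ z, A.outputProb x z = 1 := by
  simp only [outputProb, ← Complex.re_sum]
  rw [← dotProduct_sum, ← sum_mulVec, A.meas_sum, one_mulVec, inner_state_self]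

/-- Final states of inputs with different values of the computed function are far apart. -/
theorem re_inner_state_le (A : Algorithm N α) {f : (Fin N → Bool) → α} (hf : A.Computes f)
    {x y : Fin N → Bool} (hxy : f x ≠ f y) :
    (star (A.state x A.cost) ⬝ᵥ A.state y A.cost).re ≤ 17 / 18 := by
  classical
  set u := A.state x A.cost with hu
  set v := A.state y A.cost with hv
  have hE := A.meas_posSemidef (f x)
  have hsum : A.meas (f x) + ∑ z ∈ Finset.univ.erase (f x), A.meas z = 1 := by
    rw [Finset.add_sum_erase _ _ (Finset.mem_univ _), A.meas_sum]
  have hF : (∑ z ∈ Finset.univ.erase (f x), A.meas z).PosSemidef :=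
    Matrix.posSemidef_sum _ fun z _ => A.meas_posSemidef z
  set F := ∑ z ∈ Finset.univ.erase (f x), A.meas z
  have decomp : ∀ a b : BasisIndex N A.dim → ℂ, (star a ⬝ᵥ b).re
      = (star a ⬝ᵥ (A.meas (f x) *ᵥ b)).re + (star a ⬝ᵥ (F *ᵥ b)).re := by
    intro a b
    rw [← Complex.add_re, ← dotProduct_add, ← add_mulVec, hsum, one_mulVec]
  have hpx : 2 / 3 ≤ (star u ⬝ᵥ (A.meas (f x) *ᵥ u)).re := hf x
  have hpy : (star v ⬝ᵥ (A.meas (f x) *ᵥ v)).re ≤ 1 / 3 := by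
    have h1 : A.outputProb y (f x) + A.outputProb y (f y) ≤ 1 := by
      rw [← A.sum_outputProb y, ← Finset.sum_pair hxy]
      exact Finset.sum_le_sum_of_subset_of_nonneg (Finset.subset_univ _)
        fun z _ _ => A.outputProb_nonneg y z
    have h2 : A.outputProb y (f x) ≤ 1 / 3 := by linarith [hf y]
    exact h2
  have hx1 := decomp u u
  have hy1 := decomp v v
  rw [hu, inner_state_self, ← hu] at hx1
  rw [hv, inner_state_self, ← hv] at hy1
  -- The ratio 2 : 3 approximates the optimal 1 : √2. Adding both bounds gives `12 Re⟨u, v⟩ ≤ 13 - 5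
  -- * (2 / 3) + 5 * (1 / 3) = 34 / 3`.
  have h1 := hE.re_dotProduct_mulVec_le u v 2 3
  have h2 := hF.re_dotProduct_mulVec_le u v 3 2
  rw [decomp u v]
  linarith

/-- The progress measure: the sum of the real parts of the inner products of the states after `t`
queries over all ordered pairs of adjacent inputs. -/
noncomputable def progress (A : Algorithm N α) (t : ℕ) : ℝ :=
  ∑ x, ∑ i, (star (A.state x t) ⬝ᵥ A.state (flipBit x i) t).re

theorem progress_zero (A : Algorithm N α) : A.progress 0 = N * 2 ^ N := by
  have h : ∀ x i, (star (A.state x 0) ⬝ᵥ A.state (flipBit x i) 0).re = 1 :=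
    fun x i => A.inner_state_self x 0
  simp [progress, h, mul_comm]

/-- A pair loses at most its two query weights at the flipped index. For each input these weights
sum to 1 over the indices, and flipping a fixed bit permutes the inputs, so each of the two sums
equals `2 ^ N`. -/
theorem progress_sub_succ_le (A : Algorithm N α) (t : ℕ) :
    A.progress t - A.progress (t + 1) ≤ 2 * 2 ^ N := by
  have hw : ∀ x, ∑ i, queryWeight (A.state x t) i = 1 := fun x => by
    rw [sum_queryWeight, inner_state_self]
  have hcard : ∑ x : Fin N → Bool, ∑ i, queryWeight (A.state x t) i = 2 ^ N := by
    simp [hw]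
  have hflip : ∑ x, ∑ i, queryWeight (A.state (flipBit x i) t) i = 2 ^ N := by
    rw [Finset.sum_comm, ← hcard, Finset.sum_comm (s := Finset.univ (α := Fin N → Bool))]
    exact Finset.sum_congr rfl fun i _ => sum_flipBit i fun x => queryWeight (A.state x t) i
  calc A.progress t - A.progress (t + 1)
      = ∑ x, ∑ i, ((star (A.state x t) ⬝ᵥ A.state (flipBit x i) t).re
          - (star (A.state x (t + 1)) ⬝ᵥ A.state (flipBit x i) (t + 1)).re) := by
        simp only [progress, Finset.sum_sub_distrib]
    _ ≤ ∑ x, ∑ i, (queryWeight (A.state x t) i + queryWeight (A.state (flipBit x i) t) i) := by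
        refine Finset.sum_le_sum fun x _ => Finset.sum_le_sum fun i _ => ?_
        simp only [state, inner_unitary_mulVec]
        exact re_inner_sub_oracle_le x i _ _
    _ = 2 * 2 ^ N := by
        simp only [Finset.sum_add_distrib, hcard, hflip]
        ring

theorem le_progress (A : Algorithm N α) (t : ℕ) :
    (N : ℝ) * 2 ^ N - 2 * t * 2 ^ N ≤ A.progress t := by
  induction t with
  | zero => simp [progress_zero]
  | succ t ih =>
    have := A.progress_sub_succ_le t
    push_cast
    linarith

/-- A function that is sensitive to every bit at every input needs a linear number of queries. -/
theorem le_cost_of_sensitive (A : Algorithm N α) {f : (Fin N → Bool) → α} (hf : A.Computes f)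
    (hs : ∀ x i, f (flipBit x i) ≠ f x) : (N : ℝ) / 36 ≤ A.cost := by
  have hup : A.progress A.cost ≤ N * 2 ^ N * (17 / 18) := by
    calc A.progress A.cost ≤ ∑ _x : Fin N → Bool, ∑ _i : Fin N, (17 / 18 : ℝ) :=
          Finset.sum_le_sum fun x _ => Finset.sum_le_sum fun i _ =>
            A.re_inner_state_le hf (hs x i).symm
      _ = N * 2 ^ N * (17 / 18) := by
          simp
          ring
  have hlow := A.le_progress A.cost
  have hpos : (0 : ℝ) < 2 ^ N := by positivity
  have : (N : ℝ) / 36 * 2 ^ N ≤ A.cost * 2 ^ N := by linarith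
  exact le_of_mul_le_mul_right this hpos

end Algorithm

theorem le_queryComplexity {N : ℕ} {α : Type*} [Fintype α] {f : (Fin N → Bool) → α} {r : ℝ}
    (h : ∀ A : Algorithm N α, A.Computes f → r ≤ A.cost) :
    ENNReal.ofReal r ≤ ((queryComplexity f : ℕ∞) : ENNReal) := by
  -- Costs are integers, so rounding `r` up allows the infimum to be bounded inside `ℕ∞`.
  have hceil : ((⌈r⌉₊ : ℕ) : ℕ∞) ≤ queryComplexity f :=
    le_iInf₂ fun A hA => Nat.cast_le.2 (Nat.ceil_le.2 (h A hA))
  calc ENNReal.ofReal r ≤ ENNReal.ofReal (⌈r⌉₊ : ℝ) := ENNReal.ofReal_le_ofReal (Nat.le_ceil r)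
    _ = (((⌈r⌉₊ : ℕ) : ℕ∞) : ENNReal) := by simp
    _ ≤ _ := ENat.toENNReal_le.2 hceil

end QuantumQuery

theorem mainTheorem12 :
    ∃ c : ℝ, 0 < c ∧ ∀ (N q : ℕ) (hq : 3 ≤ q), (q : ℝ) ≤ (N : ℝ) / 2 →
      ENNReal.ofReal (c * Real.sqrt ((N : ℝ) * ((N : ℝ) - 2 * (q : ℝ) + 1))) ≤
        ((QuantumQuery.queryComplexity
          (QuantumQuery.countMod N (lt_of_lt_of_le three_pos hq)) : ℕ∞) : ENNReal) := by
  refine ⟨1 / 36, by norm_num, fun N q hq _ => QuantumQuery.le_queryComplexity fun A hA => ?_⟩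
  have hcost := A.le_cost_of_sensitive hA fun x i =>
    QuantumQuery.countMod_flipBit_ne (by omega) _ x i
  have hq' : (3 : ℝ) ≤ q := by exact_mod_cast hq
  have hN : (0 : ℝ) ≤ N := N.cast_nonneg
  -- Since `2 * q ≥ 1`, the second factor is at most `N`.
  have hsqrt : Real.sqrt ((N : ℝ) * ((N : ℝ) - 2 * (q : ℝ) + 1)) ≤ N := by
    rw [Real.sqrt_le_left hN, sq]
    exact mul_le_mul_of_nonneg_left (by linarith) hN
  linarith
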